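/- For $n\ge 1$ and positive reals $a=(a_1,\dots,a_n)$, the univariate box spline $B(\cdot\,|\,a)$ is the density on $\mathbb R$ of $\sum_j a_jU_j$, where $U_1,\dots,U_n$ are independent and uniform on $[0,1)$; that is, $\int_{\mathbb R}B(x|a)\varphi(x)\,dx=\int_{[0,1)^n}\varphi(a_1u_1+\cdots+a_nu_n)\,du$ for every $\varphi\in C_c^\infty(\mathbb R)$. For $n\ge2$ we take its continuous representative. Theorem. For each $n\ge1$ let $A_n=(a_{n,1},\dots,a_{n,n})$ be a vector of positive reals with $\sum_{j=1}^n a_{n,j}^2=1$, and suppose that $\max_{1\le j\le n}a_{n,j}\to0$ as $n\to\infty$ (this holds, for instance, if $\max_j a_{n,j}/\min_j a_{n,j}<c_0$ for all $n$, with a constant $c_0$ independent of $n$). Put $$G_n(x)=\sqrt{6/\pi}\,\exp\Bigl(-6\bigl(x-\tfrac12\textstyle\sum_{j=1}^n a_{n,j}\bigr)^2\Bigr).$$ Then, as $n\to\infty$, $B(\cdot\,|\,A_n)$ converges to the Gaussian $G_n$ pointwise and in $L^p(\mathbb R)$ for $p\in[2,\infty)$, in the following sense: 1. $B(x|A_n)-G_n(x)\to0$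 for every $x\in\mathbb R$; 2. $B\bigl(y+\tfrac12\sum_{j=1}^n a_{n,j}\,\big|\,A_n\bigr)\to\sqrt{6/\pi}\,e^{-6y^2}$ for every $y\in\mathbb R$; 3. $\|B(\cdot\,|\,A_n)-G_n\|_{L^p(\mathbb R)}\to0$ for every $p\in[2,\infty)$. -/

import Mathlib

open MeasureTheory Filter Topology Set

/-- The half-open unit cube `[0,1)ⁿ`. -/
def unitCube (n : ℕ) : Set (Fin n → ℝ) := {u | ∀ j, u j ∈ Ico (0 : ℝ) 1}

/-- `B` is (a representative of) the univariate box spline associated with the `1 × n` matrix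
`a = (a₁, …, aₙ)`: it is locally integrable, and
`∫ B(x) φ(x) dx = ∫_{[0,1)ⁿ} φ(a₁u₁ + ⋯ + aₙuₙ) du` for every test function `φ ∈ 𝒟(ℝ)`. -/
def IsBoxSpline {n : ℕ} (a : Fin n → ℝ) (B : ℝ → ℝ) : Prop :=
  LocallyIntegrable B ∧
    ∀ φ : ℝ → ℝ, ContDiff ℝ (⊤ : ℕ∞) φ → HasCompactSupport φ →
      ∫ x, B x * φ x = ∫ u in unitCube n, φ (∑ j, a j * u j)

/-- The univariate box spline `B(· | a)` as a function on `ℝ`. The defining rule fixes it up to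
null sets; for `n ≥ 2` it has a (unique) continuous representative, which is the one taken. -/
noncomputable def boxSpline {n : ℕ} (a : Fin n → ℝ) : ℝ → ℝ :=
  Classical.epsilon fun B : ℝ → ℝ => IsBoxSpline a B ∧ (2 ≤ n → Continuous B)

theorem volume_restrict_unitCube (n : ℕ) :
    (volume : Measure (Fin n → ℝ)).restrict (unitCube n) =
      Measure.pi fun _ : Fin n => (volume : Measure ℝ).restrict (Ico 0 1) := by
  have h : unitCube n = univ.pi fun _ => Ico (0 : ℝ) 1 := by
    ext u
    simp [unitCube, Set.mem_pi]
  rw [h, volume_pi, Measure.restrict_pi_pi]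

theorem exists_density (n : ℕ) (a : Fin (n + 1) → ℝ) (ha : ∀ j, 0 < a j) :
    ∃ B : ℝ → ℝ, (∀ x, 0 ≤ B x) ∧ Integrable B ∧ Measurable B ∧ (1 ≤ n → Continuous B) ∧
      ∀ g : ℝ → ENNReal, Measurable g →
        ∫⁻ x, ENNReal.ofReal (B x) * g x =
          ∫⁻ u, g (∑ j, a j * u j)
            ∂(Measure.pi fun _ : Fin (n + 1) => (volume : Measure ℝ).restrict (Ico 0 1)) := by
  induction n with
  | zero =>
    have hc := ha 0
    refine ⟨(Ico 0 (a 0)).indicator fun _ => (a 0)⁻¹, ?_, ?_, ?_, by simp, ?_⟩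
    · intro x
      exact indicator_nonneg (fun _ _ => (inv_pos.2 hc).le) x
    · rw [integrable_indicator_iff measurableSet_Ico]
      exact integrableOn_const (by simp)
    · exact measurable_const.indicator measurableSet_Ico
    · intro g hg
      have e := (measurePreserving_funUnique ((volume : Measure ℝ).restrict (Ico 0 1)) (Fin 1))
      have h1 : ∫⁻ u : Fin 1 → ℝ, g (∑ j, a j * u j)
            ∂(Measure.pi fun _ : Fin 1 => (volume : Measure ℝ).restrict (Ico 0 1)) =
          ∫⁻ s in Ico (0 : ℝ) 1, g (a 0 * s) := by
        rw [← e.lintegral_comp (f := fun s => g (a 0 * s)) (by fun_prop)]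
        simp
        congr!
      refine Eq.trans ?_ h1.symm
      rw [← lintegral_indicator measurableSet_Ico]
      have h2 : ∀ s : ℝ, (Ico (0 : ℝ) 1).indicator (fun s => g (a 0 * s)) s =
          (fun x => (Ico (0 : ℝ) (a 0)).indicator g x) (a 0 • s) := by
        intro s
        have : s ∈ Ico (0 : ℝ) 1 ↔ a 0 * s ∈ Ico (0 : ℝ) (a 0) := by
          simp only [mem_Ico]
          constructor
          · rintro ⟨h, h'⟩
            exact ⟨by positivity, by nlinarith⟩
          · rintro ⟨h, h'⟩
            exact ⟨by by_contra! h0; nlinarith, by by_contra! h0; nlinarith⟩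
        by_cases hs : s ∈ Ico (0 : ℝ) 1
        · simp only [smul_eq_mul]
          rw [indicator_of_mem hs, indicator_of_mem (this.1 hs)]
        · simp only [smul_eq_mul]
          rw [indicator_of_notMem hs, indicator_of_notMem (fun h => hs (this.2 h))]
      simp_rw [h2]
      have hm : Measurable fun x => (Ico (0 : ℝ) (a 0)).indicator g x :=
        hg.indicator measurableSet_Ico
      have h3 := lintegral_map (μ := volume) hm (measurable_const_smul (α := ℝ) (a 0))
      rw [← h3, Measure.map_addHaar_smul _ hc.ne', lintegral_smul_measure, smul_eq_mul,
        ← lintegral_const_mul _ hm]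
      refine lintegral_congr fun x => ?_
      by_cases hx : x ∈ Ico 0 (a 0)
      · simp [hx, abs_of_pos hc]
      · simp [hx]
  | succ n ih =>
    obtain ⟨B, hB0, hBi, hBm, -, hB⟩ := ih (fun j => a j.succ) fun j => ha _
    have hc := ha 0
    set c := a 0 with hcdef
    have hint : ∀ x, Integrable fun s => B (x - c * s) := fun x =>
      (hBi.comp_sub_left x).comp_mul_left' hc.ne'
    have hcont : Continuous fun x => ∫ s in (0 : ℝ)..1, B (x - c * s) := by
      have h : ∀ x, ∫ s in (0 : ℝ)..1, B (x - c * s) =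
          c⁻¹ • ((∫ t in (0 : ℝ)..x, B t) - ∫ t in (0 : ℝ)..(x - c), B t) := by
        intro x
        rw [intervalIntegral.integral_comp_sub_mul _ hc.ne',
          intervalIntegral.integral_interval_sub_left hBi.intervalIntegrable
            hBi.intervalIntegrable]
        simp
      simp_rw [h]
      have hp := intervalIntegral.continuous_primitive
        (fun a b => hBi.intervalIntegrable (a := a) (b := b)) 0
      exact (hp.sub (hp.comp (continuous_id.sub continuous_const))).const_smul c⁻¹
    have h0 : ∀ x, 0 ≤ ∫ s in (0 : ℝ)..1, B (x - c * s) := fun x =>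
      intervalIntegral.integral_nonneg zero_le_one fun _ _ => hB0 _
    have hof : ∀ x, ENNReal.ofReal (∫ s in (0 : ℝ)..1, B (x - c * s)) =
        ∫⁻ s in Ico (0 : ℝ) 1, ENNReal.ofReal (B (x - c * s)) := by
      intro x
      rw [intervalIntegral.integral_of_le zero_le_one, ← integral_Ico_eq_integral_Ioc,
        ofReal_integral_eq_lintegral_ofReal (hint x).integrableOn
          (Eventually.of_forall fun _ => hB0 _)]
    have key : ∀ g : ℝ → ENNReal, Measurable g →
        ∫⁻ x, ENNReal.ofReal (∫ s in (0 : ℝ)..1, B (x - c * s)) * g x =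
          ∫⁻ u, g (∑ j, a j * u j)
            ∂(Measure.pi fun _ : Fin (n + 1 + 1) =>
              (volume : Measure ℝ).restrict (Ico 0 1)) := by
      intro g hg
      have e := (measurePreserving_piFinSuccAbove
        (fun _ : Fin (n + 1 + 1) => (volume : Measure ℝ).restrict (Ico 0 1)) 0).symm
      rw [← e.lintegral_comp (f := fun u : Fin (n + 1 + 1) → ℝ => g (∑ j, a j * u j))
        (by fun_prop)]
      rw [lintegral_prod _ (by
        refine Measurable.aemeasurable ?_
        exact (show Measurable fun u : Fin (n + 1 + 1) → ℝ => g (∑ j, a j * u j) by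
          fun_prop).comp (MeasurableEquiv.measurable _))]
      have h1 : ∀ s : ℝ, ∫⁻ v : Fin (n + 1) → ℝ, g (∑ j, a j *
          (MeasurableEquiv.piFinSuccAbove (fun _ => ℝ) 0).symm (s, v) j)
            ∂(Measure.pi fun _ : Fin (n + 1) => (volume : Measure ℝ).restrict (Ico 0 1)) =
          ∫⁻ x, ENNReal.ofReal (B (x - c * s)) * g x := by
        intro s
        have h2 := hB (fun y => g (c * s + y)) (by fun_prop)
        have h3 := lintegral_add_right_eq_self (μ := (volume : Measure ℝ))
          (fun x => ENNReal.ofReal (B (x - c * s)) * g x) (c * s)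
        rw [← h3]
        simp only [add_sub_cancel_right]
        simp_rw [add_comm _ (c * s)]
        rw [h2]
        refine lintegral_congr fun v => ?_
        rw [Fin.sum_univ_succ]
        simp [MeasurableEquiv.piFinSuccAbove_symm_apply, hcdef]
      simp_rw [hof]
      have h4 : ∀ x, (∫⁻ s in Ico (0 : ℝ) 1, ENNReal.ofReal (B (x - c * s))) * g x =
          ∫⁻ s in Ico (0 : ℝ) 1, ENNReal.ofReal (B (x - c * s)) * g x := fun x =>
        (lintegral_mul_const _ (by fun_prop)).symm
      simp_rw [h4]
      rw [lintegral_lintegral_swap (by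
        refine Measurable.aemeasurable ?_
        simp only [Function.uncurry_def]
        fun_prop)]
      exact lintegral_congr fun s => (h1 s).symm
    refine ⟨_, h0, ?_, hcont.measurable, fun _ => hcont, key⟩
    refine ⟨hcont.aestronglyMeasurable, ?_⟩
    rw [hasFiniteIntegral_iff_ofReal (Eventually.of_forall h0)]
    have := key (fun _ => 1) measurable_const
    simp only [mul_one] at this
    rw [this]
    simp

/-- A box spline with positive coefficients exists, and it may be taken continuous if `2 ≤ n`. -/
theorem exists_isBoxSpline {n : ℕ} (hn : 1 ≤ n) (a : Fin n → ℝ) (ha : ∀ j, 0 < a j) :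
    ∃ B : ℝ → ℝ, IsBoxSpline a B ∧ (2 ≤ n → Continuous B) := by
  obtain ⟨m, rfl⟩ : ∃ m, n = m + 1 := ⟨n - 1, by omega⟩
  obtain ⟨B, hB0, hBi, hBm, hBc, hB⟩ := exists_density m a ha
  refine ⟨B, ⟨hBi.locallyIntegrable, fun φ hφ _ => ?_⟩, fun h => hBc (by omega)⟩
  have hmap : (Measure.pi fun _ : Fin (m + 1) => (volume : Measure ℝ).restrict (Ico 0 1)).map
      (fun u => ∑ j, a j * u j) = volume.withDensity fun x => ENNReal.ofReal (B x) := by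
    refine Measure.ext_of_lintegral _ fun g hg => ?_
    rw [lintegral_map hg (by fun_prop), ← hB g hg,
      lintegral_withDensity_eq_lintegral_mul _ (by fun_prop) hg]
    rfl
  rw [volume_restrict_unitCube, ← integral_map (φ := fun u : Fin (m + 1) → ℝ => ∑ j, a j * u j)
    (Measurable.aemeasurable (by fun_prop)) hφ.continuous.aestronglyMeasurable, hmap,
    integral_withDensity_eq_integral_toReal_smul (by fun_prop) (by simp)]
  refine integral_congr_ae (Eventually.of_forall fun x => ?_)
  simp [ENNReal.toReal_ofReal (hB0 x)]

theorem isBoxSpline_boxSpline {n : ℕ} (hn : 1 ≤ n) (a : Fin n → ℝ) (ha : ∀ j, 0 < a j) :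
    IsBoxSpline a (boxSpline a) :=
  (Classical.epsilon_spec (exists_isBoxSpline hn a ha)).1

theorem continuous_boxSpline {n : ℕ} (hn : 2 ≤ n) (a : Fin n → ℝ) (ha : ∀ j, 0 < a j) :
    Continuous (boxSpline a) :=
  (Classical.epsilon_spec (exists_isBoxSpline (by omega) a ha)).2 hn

/-- The defining rule and continuity determine a box spline at every point. -/
theorem IsBoxSpline.eq_of_continuous {n : ℕ} {a : Fin n → ℝ} {B B' : ℝ → ℝ}
    (h : IsBoxSpline a B) (h' : IsBoxSpline a B') (hc : Continuous B) (hc' : Continuous B') :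
    B = B' := by
  refine (hc.ae_eq_iff_eq volume hc').1 ?_
  refine ae_eq_of_integral_contDiff_smul_eq h.1 h'.1 fun g hg hs => ?_
  have h1 := h.2 g hg hs
  have h2 := h'.2 g hg hs
  simp only [smul_eq_mul, mul_comm (g _)]
  rw [h1, h2]

open scoped FourierTransform

/-- A continuous box spline is the nonnegative integrable density of `∑ a_j U_j`. -/
theorem boxSpline_density {n : ℕ} (hn : 2 ≤ n) (a : Fin n → ℝ) (ha : ∀ j, 0 < a j) :
    (∀ x, 0 ≤ boxSpline a x) ∧ Integrable (boxSpline a) ∧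
      (Measure.pi fun _ : Fin n => (volume : Measure ℝ).restrict (Ico 0 1)).map
        (fun u => ∑ j, a j * u j) = volume.withDensity fun x => ENNReal.ofReal (boxSpline a x) := by
  obtain ⟨m, rfl⟩ : ∃ m, n = m + 1 := ⟨n - 1, by omega⟩
  obtain ⟨B, hB0, hBi, hBm, hBc, hB⟩ := exists_density m a ha
  have hmap : (Measure.pi fun _ : Fin (m + 1) => (volume : Measure ℝ).restrict (Ico 0 1)).map
      (fun u => ∑ j, a j * u j) = volume.withDensity fun x => ENNReal.ofReal (B x) := by
    refine Measure.ext_of_lintegral _ fun g hg => ?_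
    rw [lintegral_map hg (by fun_prop), ← hB g hg,
      lintegral_withDensity_eq_lintegral_mul _ (by fun_prop) hg]
    rfl
  have hbox : IsBoxSpline a B := by
    refine ⟨hBi.locallyIntegrable, fun φ hφ _ => ?_⟩
    rw [volume_restrict_unitCube, ← integral_map (φ := fun u : Fin (m + 1) → ℝ => ∑ j, a j * u j)
      (Measurable.aemeasurable (by fun_prop)) hφ.continuous.aestronglyMeasurable, hmap,
      integral_withDensity_eq_integral_toReal_smul (by fun_prop) (by simp)]
    refine integral_congr_ae (Eventually.of_forall fun x => ?_)
    simp [ENNReal.toReal_ofReal (hB0 x)]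
  have heq : boxSpline a = B := (isBoxSpline_boxSpline (by omega) a ha).eq_of_continuous hbox
    (continuous_boxSpline hn a ha) (hBc (by omega))
  rw [heq]
  exact ⟨hB0, hBi, hmap⟩

theorem lintegral_ofReal_boxSpline {n : ℕ} (hn : 2 ≤ n) (a : Fin n → ℝ) (ha : ∀ j, 0 < a j) :
    ∫⁻ x, ENNReal.ofReal (boxSpline a x) = 1 := by
  have h := congrArg (fun μ : Measure ℝ => μ univ) (boxSpline_density hn a ha).2.2
  simp only [withDensity_apply _ MeasurableSet.univ, Measure.restrict_univ] at h
  rw [← h, Measure.map_apply (by fun_prop) MeasurableSet.univ]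
  simp [Measure.pi_univ]

theorem Real.abs_sinc_le_rpow (x : ℝ) : |Real.sinc x| ≤ (1 + x ^ 2 / 4) ^ (-(1 / 2) : ℝ) := by
  have hpos : (0 : ℝ) < 1 + x ^ 2 / 4 := by positivity
  have hsq : Real.sinc x ^ 2 * (1 + x ^ 2 / 4) ≤ 1 := by
    rcases eq_or_ne x 0 with rfl | hx
    · simp
    rw [Real.sinc_of_ne_zero hx, div_pow, div_mul_eq_mul_div, div_le_one (by positivity)]
    rcases le_total |x| 2 with h | h
    · obtain ⟨h1, h2⟩ := abs_le.1 h
      have hpi := Real.pi_gt_three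
      have hc := Real.cos_le_one_div_sqrt_sq_add_one (x := x / 2) (by linarith) (by linarith)
      have hc0 : 0 ≤ Real.cos (x / 2) := Real.cos_nonneg_of_mem_Icc ⟨by linarith, by linarith⟩
      have hc2 : Real.cos (x / 2) ^ 2 * (1 + x ^ 2 / 4) ≤ 1 := by
        have := pow_le_pow_left₀ hc0 hc 2
        rw [div_pow, Real.sq_sqrt (by positivity), le_div_iff₀ (by positivity)] at this
        linarith
      have hs2 : Real.sin (x / 2) ^ 2 ≤ (x / 2) ^ 2 := sq_le_sq.2 Real.abs_sin_le_abs
      have hd : Real.sin x = 2 * Real.sin (x / 2) * Real.cos (x / 2) := by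
        rw [← Real.sin_two_mul]; ring_nf
      rw [hd]
      calc (2 * Real.sin (x / 2) * Real.cos (x / 2)) ^ 2 * (1 + x ^ 2 / 4)
          = 4 * Real.sin (x / 2) ^ 2 * (Real.cos (x / 2) ^ 2 * (1 + x ^ 2 / 4)) := by ring
        _ ≤ 4 * Real.sin (x / 2) ^ 2 * 1 := by gcongr
        _ ≤ x ^ 2 := by linarith
    · have : 4 ≤ x ^ 2 := by
        rw [← sq_abs]; nlinarith
      nlinarith [Real.sin_sq_le_one x]
  rw [Real.rpow_neg hpos.le, ← Real.sqrt_eq_rpow, ← Real.sqrt_inv]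
  refine Real.abs_le_sqrt ?_
  rw [← one_div, le_div_iff₀ hpos]
  exact hsq

theorem Real.abs_sinc_sub_exp_le {x : ℝ} (hx : |x| ≤ 1) :
    |Real.sinc x - Real.exp (-(x ^ 2 / 6))| ≤ |x| ^ 3 := by
  have h0 := abs_nonneg x
  have hsq : x ^ 2 = |x| ^ 2 := (sq_abs x).symm
  have h1 : |Real.sinc x - (1 - x ^ 2 / 6)| ≤ |x| ^ 4 / 100 := by
    rcases eq_or_ne x 0 with rfl | hx0
    · simp
    have hb := Real.sin_bound hx
    have he : Real.sin x - (x - x ^ 3 / 6) = x * (Real.sinc x - (1 - x ^ 2 / 6)) := by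
      rw [Real.sinc_of_ne_zero hx0]; field_simp
    rw [he, abs_mul] at hb
    refine le_of_mul_le_mul_left (hb.trans_eq ?_) (abs_pos.2 hx0)
    ring
  have h2 : |Real.exp (-(x ^ 2 / 6)) - (1 - x ^ 2 / 6)| ≤ |x| ^ 4 / 36 := by
    have hb := Real.abs_exp_sub_one_sub_id_le (x := -(x ^ 2 / 6)) (by
      rw [abs_neg, abs_of_nonneg (by positivity), hsq]; nlinarith)
    rw [hsq] at hb ⊢
    calc _ = |Real.exp (-(|x| ^ 2 / 6)) - 1 - -(|x| ^ 2 / 6)| := by congr 1; ring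
      _ ≤ _ := hb
      _ = _ := by ring
  have h4 : |x| ^ 4 ≤ |x| ^ 3 := pow_le_pow_of_le_one h0 hx (by norm_num)
  have h3 : 0 ≤ |x| ^ 3 := by positivity
  have := abs_sub_le (Real.sinc x) (1 - x ^ 2 / 6) (Real.exp (-(x ^ 2 / 6)))
  rw [abs_sub_comm (1 - x ^ 2 / 6)] at this
  linarith

theorem abs_prod_sub_prod_le {ι : Type*} (s : Finset ι) (f g : ι → ℝ) (hf : ∀ i ∈ s, |f i| ≤ 1)
    (hg : ∀ i ∈ s, |g i| ≤ 1) : |∏ i ∈ s, f i - ∏ i ∈ s, g i| ≤ ∑ i ∈ s, |f i - g i| := by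
  classical
  induction s using Finset.induction_on with
  | empty => simp
  | insert i s hi ih =>
    rw [Finset.prod_insert hi, Finset.prod_insert hi, Finset.sum_insert hi]
    have ih' := ih (fun j hj => hf j (Finset.mem_insert_of_mem hj))
      fun j hj => hg j (Finset.mem_insert_of_mem hj)
    have hp : |∏ j ∈ s, f j| ≤ 1 := by
      rw [Finset.abs_prod]
      exact Finset.prod_le_one (fun _ _ => abs_nonneg _)
        fun j hj => hf j (Finset.mem_insert_of_mem hj)
    have hgi := hg i (Finset.mem_insert_self i s)
    calc |f i * ∏ j ∈ s, f j - g i * ∏ j ∈ s, g j|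
        = |(f i - g i) * ∏ j ∈ s, f j + g i * (∏ j ∈ s, f j - ∏ j ∈ s, g j)| := by congr 1; ring
      _ ≤ |f i - g i| * |∏ j ∈ s, f j| + |g i| * |∏ j ∈ s, f j - ∏ j ∈ s, g j| := by
        rw [← abs_mul, ← abs_mul]; exact abs_add_le _ _
      _ ≤ |f i - g i| * 1 + 1 * |∏ j ∈ s, f j - ∏ j ∈ s, g j| := by gcongr
      _ ≤ _ := by linarith

/-- If no coefficient dominates, the characteristic function decays quadratically. -/
theorem abs_prod_sinc_le {n : ℕ} (a : Fin n → ℝ) (hunit : ∑ j, a j ^ 2 = 1)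
    (hle : ∀ j, a j ^ 2 ≤ 1 / 2) (ξ : ℝ) :
    |∏ j, Real.sinc (Real.pi * a j * ξ)| ≤ (1 + ξ ^ 2)⁻¹ := by
  set t : ℝ := 1 + Real.pi ^ 2 * ξ ^ 2 / 8 with ht
  have htpos : 0 < t := by positivity
  have hfac : ∀ j, |Real.sinc (Real.pi * a j * ξ)| ≤ t ^ (-(a j ^ 2)) := by
    intro j
    have hb := rpow_one_add_le_one_add_mul_self (s := Real.pi ^ 2 * ξ ^ 2 / 8)
      (by have : 0 ≤ Real.pi ^ 2 * ξ ^ 2 / 8 := by positivity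
          linarith) (p := 2 * a j ^ 2) (by positivity) (by linarith [hle j])
    have he : 1 + (Real.pi * a j * ξ) ^ 2 / 4 = 1 + 2 * a j ^ 2 * (Real.pi ^ 2 * ξ ^ 2 / 8) := by
      ring
    calc |Real.sinc (Real.pi * a j * ξ)|
        ≤ (1 + (Real.pi * a j * ξ) ^ 2 / 4) ^ (-(1 / 2) : ℝ) := Real.abs_sinc_le_rpow _
      _ ≤ (t ^ (2 * a j ^ 2)) ^ (-(1 / 2) : ℝ) := by
        rw [he]
        exact Real.rpow_le_rpow_of_nonpos (by positivity) hb (by norm_num)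
      _ = t ^ (-(a j ^ 2)) := by
        rw [← Real.rpow_mul htpos.le]; congr 1; ring
  calc |∏ j, Real.sinc (Real.pi * a j * ξ)| = ∏ j, |Real.sinc (Real.pi * a j * ξ)| :=
        Finset.abs_prod _ _
    _ ≤ ∏ j, t ^ (-(a j ^ 2)) := Finset.prod_le_prod (fun _ _ => abs_nonneg _) fun j _ => hfac j
    _ = t⁻¹ := by
      rw [← Real.rpow_sum_of_pos htpos, Finset.sum_neg_distrib, hunit, Real.rpow_neg_one]
    _ ≤ (1 + ξ ^ 2)⁻¹ := by
      have : 8 * ξ ^ 2 ≤ Real.pi ^ 2 * ξ ^ 2 := by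
        gcongr
        nlinarith [Real.pi_gt_three]
      exact inv_anti₀ (by positivity) (by rw [ht]; linarith)

theorem abs_prod_sinc_sub_exp_le {n : ℕ} (a : Fin n → ℝ) (ha : ∀ j, 0 < a j)
    (hunit : ∑ j, a j ^ 2 = 1) {ε ξ : ℝ} (hε : ∀ j, a j ≤ ε) (hξ : Real.pi * ε * |ξ| ≤ 1) :
    |∏ j, Real.sinc (Real.pi * a j * ξ) - Real.exp (-(Real.pi ^ 2 * ξ ^ 2 / 6))| ≤
      ε * (Real.pi * |ξ|) ^ 3 := by
  have hexp : Real.exp (-(Real.pi ^ 2 * ξ ^ 2 / 6)) =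
      ∏ j, Real.exp (-((Real.pi * a j * ξ) ^ 2 / 6)) := by
    rw [← Real.exp_sum]
    congr 1
    calc -(Real.pi ^ 2 * ξ ^ 2 / 6) = -(Real.pi ^ 2 * ξ ^ 2 / 6) * ∑ j, a j ^ 2 := by
          rw [hunit, mul_one]
      _ = _ := by rw [Finset.mul_sum]; exact Finset.sum_congr rfl fun j _ => by ring
  have habs : ∀ j, |Real.pi * a j * ξ| = a j * (Real.pi * |ξ|) := fun j => by
    rw [abs_mul, abs_mul, abs_of_pos Real.pi_pos, abs_of_pos (ha j)]; ring
  have hpi := Real.pi_pos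
  rw [hexp]
  refine (abs_prod_sub_prod_le _ _ _ (fun j _ => Real.abs_sinc_le_one _) fun j _ => ?_).trans ?_
  · rw [Real.abs_exp, Real.exp_le_one_iff]
    have : 0 ≤ (Real.pi * a j * ξ) ^ 2 / 6 := by positivity
    linarith
  calc ∑ j, |Real.sinc (Real.pi * a j * ξ) - Real.exp (-((Real.pi * a j * ξ) ^ 2 / 6))|
      ≤ ∑ j, a j ^ 2 * (ε * (Real.pi * |ξ|) ^ 3) := by
        refine Finset.sum_le_sum fun j _ => ?_
        refine (Real.abs_sinc_sub_exp_le ?_).trans ?_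
        · rw [habs]
          calc a j * (Real.pi * |ξ|) ≤ ε * (Real.pi * |ξ|) := by gcongr; exact hε j
            _ ≤ 1 := by linarith
        · rw [habs]
          calc (a j * (Real.pi * |ξ|)) ^ 3 = a j ^ 2 * (a j * (Real.pi * |ξ|) ^ 3) := by ring
            _ ≤ _ := by gcongr; exact hε j
    _ = _ := by rw [← Finset.sum_mul, hunit, one_mul]

theorem integral_exp_mul_Ico (c ξ : ℝ) :
    ∫ u in Ico (0 : ℝ) 1, Complex.exp (((-2 * Real.pi * (c * u) * ξ : ℝ) : ℂ) * Complex.I) =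
      Complex.exp (((-Real.pi * c * ξ : ℝ) : ℂ) * Complex.I) * Real.sinc (Real.pi * c * ξ) := by
  rw [integral_Ico_eq_integral_Ioc, ← intervalIntegral.integral_of_le zero_le_one]
  set r : ℝ := Real.pi * c * ξ with hr
  rcases eq_or_ne r 0 with h0 | h0
  · have h1 : ∀ u : ℝ, -2 * Real.pi * (c * u) * ξ = 0 := fun u => by
      linear_combination (-2 * u) * h0 + (2 * u) * hr
    have h2 : -Real.pi * c * ξ = 0 := by linear_combination -h0 + hr
    simp only [h1, h2, h0]
    simp
  have h := integral_exp_mul_I_eq_sinc r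
  have hs := intervalIntegral.integral_comp_sub_mul
    (fun x : ℝ => Complex.exp ((x : ℂ) * Complex.I)) (a := 0) (b := 1)
    (mul_ne_zero two_ne_zero h0) r
  rw [show r - 2 * r * 1 = -r by ring, show r - 2 * r * 0 = r by ring, h] at hs
  have hsplit : ∀ u : ℝ, Complex.exp (((-2 * Real.pi * (c * u) * ξ : ℝ) : ℂ) * Complex.I) =
      Complex.exp (((-Real.pi * c * ξ : ℝ) : ℂ) * Complex.I) *
        Complex.exp (((r - 2 * r * u : ℝ) : ℂ) * Complex.I) := fun u => by
    rw [← Complex.exp_add, ← add_mul, ← Complex.ofReal_add]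
    congr 3
    rw [hr]; ring
  simp_rw [hsplit]
  rw [intervalIntegral.integral_const_mul, hs]
  congr 1
  rw [Complex.real_smul]
  push_cast
  have : (r : ℂ) ≠ 0 := by exact_mod_cast h0
  field_simp

theorem fourier_boxSpline {n : ℕ} (hn : 2 ≤ n) (a : Fin n → ℝ) (ha : ∀ j, 0 < a j) (ξ : ℝ) :
    𝓕 (fun x => (boxSpline a x : ℂ)) ξ =
      Complex.exp (((-Real.pi * (∑ j, a j) * ξ : ℝ) : ℂ) * Complex.I) *
        ((∏ j, Real.sinc (Real.pi * a j * ξ) : ℝ) : ℂ) := by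
  obtain ⟨h0, hi, hmap⟩ := boxSpline_density hn a ha
  rw [Real.fourier_real_eq_integral_exp_smul]
  have h1 : ∫ x : ℝ, Complex.exp (((-2 * Real.pi * x * ξ : ℝ) : ℂ) * Complex.I) •
        (boxSpline a x : ℂ) =
      ∫ x, Complex.exp (((-2 * Real.pi * x * ξ : ℝ) : ℂ) * Complex.I)
        ∂(volume.withDensity fun x => ENNReal.ofReal (boxSpline a x)) := by
    rw [integral_withDensity_eq_integral_toReal_smul
      (continuous_boxSpline hn a ha).measurable.ennreal_ofReal (by simp)]
    refine integral_congr_ae (Eventually.of_forall fun x => ?_)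
    simp only [ENNReal.toReal_ofReal (h0 x), Complex.real_smul, smul_eq_mul]
    ring
  rw [h1, ← hmap, integral_map (Measurable.aemeasurable (by fun_prop))
    (Continuous.aestronglyMeasurable (by fun_prop))]
  have h2 : ∀ u : Fin n → ℝ,
      Complex.exp (((-2 * Real.pi * (∑ j, a j * u j) * ξ : ℝ) : ℂ) * Complex.I) =
        ∏ j, Complex.exp (((-2 * Real.pi * (a j * u j) * ξ : ℝ) : ℂ) * Complex.I) := fun u => by
    rw [← Complex.exp_sum, ← Finset.sum_mul, ← Complex.ofReal_sum, Finset.mul_sum, Finset.sum_mul]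
  simp_rw [h2]
  rw [integral_fintype_prod_eq_prod (𝕜 := ℂ) (μ := fun _ => volume.restrict (Ico (0 : ℝ) 1))
    fun (j : Fin n) (u : ℝ) => Complex.exp (((-2 * Real.pi * (a j * u) * ξ : ℝ) : ℂ) * Complex.I)]
  simp_rw [integral_exp_mul_Ico]
  rw [Finset.prod_mul_distrib, ← Complex.exp_sum, ← Finset.sum_mul, ← Complex.ofReal_sum,
    ← Complex.ofReal_prod, Finset.mul_sum, Finset.sum_mul]

theorem integrable_prod_sinc {n : ℕ} (a : Fin n → ℝ) (hunit : ∑ j, a j ^ 2 = 1)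
    (hle : ∀ j, a j ^ 2 ≤ 1 / 2) : Integrable fun ξ => ∏ j, Real.sinc (Real.pi * a j * ξ) := by
  refine integrable_inv_one_add_sq.mono' (Continuous.aestronglyMeasurable ?_)
    (Eventually.of_forall fun ξ => abs_prod_sinc_le a hunit hle ξ)
  exact continuous_finsetProd _ fun j _ => Real.continuous_sinc.comp (by fun_prop)

theorem boxSpline_eq_integral {n : ℕ} (hn : 2 ≤ n) (a : Fin n → ℝ) (ha : ∀ j, 0 < a j)
    (hunit : ∑ j, a j ^ 2 = 1) (hle : ∀ j, a j ^ 2 ≤ 1 / 2) (x : ℝ) :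
    (boxSpline a x : ℂ) = ∫ ξ : ℝ,
      Complex.exp (((2 * Real.pi * (x - (∑ j, a j) / 2) * ξ : ℝ) : ℂ) * Complex.I) *
        ((∏ j, Real.sinc (Real.pi * a j * ξ) : ℝ) : ℂ) := by
  have hF : 𝓕 (fun x => (boxSpline a x : ℂ)) = fun ξ =>
      Complex.exp (((-Real.pi * (∑ j, a j) * ξ : ℝ) : ℂ) * Complex.I) *
        ((∏ j, Real.sinc (Real.pi * a j * ξ) : ℝ) : ℂ) := funext (fourier_boxSpline hn a ha)
  have hFi : Integrable (𝓕 (fun x => (boxSpline a x : ℂ))) := by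
    rw [hF]
    refine (integrable_prod_sinc a hunit hle).ofReal.bdd_mul (c := 1)
      (Continuous.aestronglyMeasurable (by fun_prop)) (Eventually.of_forall fun ξ => ?_)
    rw [Complex.norm_exp_ofReal_mul_I]
  have hinv := (boxSpline_density hn a ha).2.1.ofReal (𝕜 := ℂ) |>.fourierInv_fourier_eq hFi
    (v := x) (Complex.continuous_ofReal.comp (continuous_boxSpline hn a ha)).continuousAt
  refine hinv.symm.trans ?_
  rw [Real.fourierInv_eq']
  refine integral_congr_ae (Eventually.of_forall fun ξ => ?_)
  have hξ := congrFun hF ξ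
  simp only [RCLike.inner_apply, conj_trivial, smul_eq_mul]
  refine (congrArg _ hξ).trans ?_
  rw [← mul_assoc, ← Complex.exp_add, ← add_mul, ← Complex.ofReal_add]
  congr 4
  ring

theorem gaussian_eq_integral (y : ℝ) :
    ((√(6 / Real.pi) * Real.exp (-6 * y ^ 2) : ℝ) : ℂ) = ∫ ξ : ℝ,
      Complex.exp (((2 * Real.pi * y * ξ : ℝ) : ℂ) * Complex.I) *
        ((Real.exp (-(Real.pi ^ 2 * ξ ^ 2 / 6)) : ℝ) : ℂ) := by
  have hpi := Real.pi_pos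
  have hpi0 : (Real.pi : ℂ) ≠ 0 := by exact_mod_cast hpi.ne'
  have h := fourierIntegral_gaussian (b := ((Real.pi ^ 2 / 6 : ℝ) : ℂ))
    (by rw [Complex.ofReal_re]; positivity) ((2 * Real.pi * y : ℝ) : ℂ)
  have hsqrt : ((√(6 / Real.pi) : ℝ) : ℂ) =
      ((Real.pi : ℂ) / ((Real.pi ^ 2 / 6 : ℝ) : ℂ)) ^ (1 / 2 : ℂ) := by
    rw [Real.sqrt_eq_rpow, Complex.ofReal_cpow (by positivity)]
    congr 1
    · push_cast; field_simp
    · push_cast; rfl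
  have hexp : ((Real.exp (-6 * y ^ 2) : ℝ) : ℂ) =
      Complex.exp (-((2 * Real.pi * y : ℝ) : ℂ) ^ 2 / (4 * ((Real.pi ^ 2 / 6 : ℝ) : ℂ))) := by
    rw [Complex.ofReal_exp]
    congr 1
    push_cast
    field_simp
    ring
  rw [Complex.ofReal_mul, hsqrt, hexp, ← h]
  refine integral_congr_ae (Eventually.of_forall fun ξ => ?_)
  simp only [Complex.ofReal_exp]
  congr 2
  · push_cast; ring
  · push_cast; ring

theorem integrable_exp_neg_pi_sq : Integrable fun ξ : ℝ => Real.exp (-(Real.pi ^ 2 * ξ ^ 2 / 6)) := by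
  have := integrable_exp_neg_mul_sq (b := Real.pi ^ 2 / 6) (by positivity)
  refine this.congr (Eventually.of_forall fun ξ => ?_)
  simp only
  congr 1
  ring

theorem integrable_exp_mul_I_mul_ofReal (t : ℝ) {f : ℝ → ℝ} (hf : Integrable f) :
    Integrable fun ξ : ℝ => Complex.exp (((t * ξ : ℝ) : ℂ) * Complex.I) * (f ξ : ℂ) :=
  hf.ofReal.bdd_mul (c := 1) (Continuous.aestronglyMeasurable (by fun_prop))
    (Eventually.of_forall fun ξ => by rw [Complex.norm_exp_ofReal_mul_I])

theorem abs_boxSpline_sub_gaussian_le {n : ℕ} (hn : 2 ≤ n) (a : Fin n → ℝ) (ha : ∀ j, 0 < a j)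
    (hunit : ∑ j, a j ^ 2 = 1) (hle : ∀ j, a j ^ 2 ≤ 1 / 2) (x : ℝ) :
    |boxSpline a x - √(6 / Real.pi) * Real.exp (-6 * (x - (∑ j, a j) / 2) ^ 2)| ≤
      ∫ ξ : ℝ, |∏ j, Real.sinc (Real.pi * a j * ξ) - Real.exp (-(Real.pi ^ 2 * ξ ^ 2 / 6))| := by
  rw [← Real.norm_eq_abs, ← Complex.norm_real, Complex.ofReal_sub,
    boxSpline_eq_integral hn a ha hunit hle, gaussian_eq_integral, ← integral_sub
      (integrable_exp_mul_I_mul_ofReal _ (integrable_prod_sinc a hunit hle))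
      (integrable_exp_mul_I_mul_ofReal _ integrable_exp_neg_pi_sq)]
  refine (norm_integral_le_integral_norm _).trans_eq ?_
  refine integral_congr_ae (Eventually.of_forall fun ξ => ?_)
  simp only
  rw [← mul_sub, norm_mul, Complex.norm_exp_ofReal_mul_I, one_mul, ← Complex.ofReal_sub,
    Complex.norm_real, Real.norm_eq_abs]

section
variable (A : (n : ℕ) → Fin n → ℝ)

theorem eventually_regular (hpos : ∀ n, ∀ j, 0 < A n j)
    (hunit : ∀ n, 1 ≤ n → ∑ j, A n j ^ 2 = 1)
    (hmax : ∀ ε : ℝ, 0 < ε → ∀ᶠ n in atTop, ∀ j, A n j < ε) :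
    ∀ᶠ n in atTop, 2 ≤ n ∧ ∑ j, A n j ^ 2 = 1 ∧ ∀ j, A n j ^ 2 ≤ 1 / 2 := by
  filter_upwards [eventually_ge_atTop 2, hmax (1 / 2) (by norm_num)] with n hn hm
  exact ⟨hn, hunit n (by omega), fun j => by nlinarith [hpos n j, hm j]⟩

theorem tendsto_integral_abs_prod_sinc_sub_exp (hpos : ∀ n, ∀ j, 0 < A n j)
    (hunit : ∀ n, 1 ≤ n → ∑ j, A n j ^ 2 = 1)
    (hmax : ∀ ε : ℝ, 0 < ε → ∀ᶠ n in atTop, ∀ j, A n j < ε) :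
    Tendsto (fun n => ∫ ξ : ℝ,
      |∏ j, Real.sinc (Real.pi * A n j * ξ) - Real.exp (-(Real.pi ^ 2 * ξ ^ 2 / 6))|)
      atTop (𝓝 0) := by
  have hz : (0 : ℝ) = ∫ _ : ℝ, (0 : ℝ) := by simp
  rw [hz]
  refine tendsto_integral_filter_of_dominated_convergence
    (fun ξ => (1 + ξ ^ 2)⁻¹ + Real.exp (-(Real.pi ^ 2 * ξ ^ 2 / 6))) ?_ ?_
    (integrable_inv_one_add_sq.add integrable_exp_neg_pi_sq) ?_
  · refine Eventually.of_forall fun n => Continuous.aestronglyMeasurable ?_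
    refine Continuous.abs (Continuous.sub ?_ (by fun_prop))
    exact continuous_finsetProd _ fun j _ => Real.continuous_sinc.comp (by fun_prop)
  · filter_upwards [eventually_regular A hpos hunit hmax] with n ⟨_, hu, hle⟩
    refine Eventually.of_forall fun ξ => ?_
    rw [Real.norm_eq_abs, abs_abs]
    refine (abs_sub _ _).trans ?_
    rw [Real.abs_exp]
    gcongr
    exact abs_prod_sinc_le (A n) hu hle ξ
  · refine Eventually.of_forall fun ξ => ?_
    have hpi := Real.pi_pos
    rw [Metric.tendsto_atTop']
    intro δ hδ
    set M : ℝ := (Real.pi * |ξ|) ^ 3 with hM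
    have hM0 : 0 ≤ M := by positivity
    set ε : ℝ := min (1 / (Real.pi * |ξ| + 1)) (δ / (2 * (M + 1))) with hε
    have hε0 : 0 < ε := lt_min (by positivity) (by positivity)
    have hev := (hmax ε hε0).and (eventually_ge_atTop 1)
    obtain ⟨N, hN⟩ := eventually_atTop.1 hev
    refine ⟨N, fun n hn => ?_⟩
    obtain ⟨hm, hn1⟩ := hN n hn.le
    have h1 : Real.pi * ε * |ξ| ≤ 1 := by
      have h := (le_div_iff₀ (by positivity)).1 (min_le_left _ _ : ε ≤ 1 / (Real.pi * |ξ| + 1))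
      nlinarith
    have h2 : ε * M < δ := by
      have h := (le_div_iff₀ (by positivity)).1 (min_le_right _ _ : ε ≤ δ / (2 * (M + 1)))
      nlinarith
    rw [dist_zero_right, Real.norm_eq_abs, abs_abs]
    exact (abs_prod_sinc_sub_exp_le (A n) (hpos n) (hunit n hn1) (fun j => (hm j).le) h1).trans_lt h2

end

theorem eLpNorm_le_of_abs_le {α : Type*} {m : MeasurableSpace α} {μ : Measure α} {f : α → ℝ}
    {D p : ℝ} {C : ENNReal} (hp : 1 ≤ p) (hD : ∀ x, |f x| ≤ D) (hC : ∫⁻ x, ‖f x‖ₑ ∂μ ≤ C) :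
    eLpNorm f (ENNReal.ofReal p) μ ≤ (ENNReal.ofReal D ^ (p - 1) * C) ^ (1 / p) := by
  have hp0 : 0 < p := by linarith
  rw [eLpNorm_eq_lintegral_rpow_enorm_toReal (by simpa using hp0) (by simp),
    ENNReal.toReal_ofReal hp0.le]
  refine ENNReal.rpow_le_rpow ?_ (by positivity)
  by_cases htop : ENNReal.ofReal D ^ (p - 1) = ⊤
  · exact absurd htop (ENNReal.rpow_ne_top_of_nonneg (by linarith) (by simp))
  calc ∫⁻ x, ‖f x‖ₑ ^ p ∂μ ≤ ∫⁻ x, ENNReal.ofReal D ^ (p - 1) * ‖f x‖ₑ ∂μ := by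
        refine lintegral_mono fun x => ?_
        have hx : ‖f x‖ₑ ≤ ENNReal.ofReal D := by
          rw [Real.enorm_eq_ofReal_abs]; exact ENNReal.ofReal_le_ofReal (hD x)
        calc ‖f x‖ₑ ^ p = ‖f x‖ₑ ^ (p - 1 + 1) := by rw [sub_add_cancel]
          _ = ‖f x‖ₑ ^ (p - 1) * ‖f x‖ₑ := by
            rw [ENNReal.rpow_add_of_nonneg _ _ (by linarith) zero_le_one, ENNReal.rpow_one]
          _ ≤ _ := by gcongr
    _ = ENNReal.ofReal D ^ (p - 1) * ∫⁻ x, ‖f x‖ₑ ∂μ := lintegral_const_mul' _ _ htop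
    _ ≤ _ := by gcongr

theorem lintegral_enorm_gaussian_sub (c : ℝ) :
    ∫⁻ x, ‖√(6 / Real.pi) * Real.exp (-6 * (x - c) ^ 2)‖ₑ =
      ∫⁻ x, ‖√(6 / Real.pi) * Real.exp (-6 * x ^ 2)‖ₑ :=
  lintegral_sub_right_eq_self (fun x => ‖√(6 / Real.pi) * Real.exp (-6 * x ^ 2)‖ₑ) c

theorem lintegral_enorm_gaussian_ne_top :
    ∫⁻ x, ‖√(6 / Real.pi) * Real.exp (-6 * x ^ 2)‖ₑ ≠ ⊤ :=
  ((integrable_exp_neg_mul_sq (b := 6) (by norm_num)).const_mul (√(6 / Real.pi))).2.ne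

theorem lintegral_enorm_boxSpline_sub_gaussian_le {n : ℕ} (hn : 2 ≤ n) (a : Fin n → ℝ)
    (ha : ∀ j, 0 < a j) (c : ℝ) :
    ∫⁻ x, ‖boxSpline a x - √(6 / Real.pi) * Real.exp (-6 * (x - c) ^ 2)‖ₑ ≤
      1 + ∫⁻ x, ‖√(6 / Real.pi) * Real.exp (-6 * x ^ 2)‖ₑ := by
  calc _ ≤ ∫⁻ x, (ENNReal.ofReal (boxSpline a x) +
        ‖√(6 / Real.pi) * Real.exp (-6 * (x - c) ^ 2)‖ₑ) := by
        refine lintegral_mono fun x => (enorm_sub_le).trans_eq ?_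
        rw [Real.enorm_of_nonneg ((boxSpline_density hn a ha).1 x)]
    _ = _ := by
      rw [lintegral_add_left (continuous_boxSpline hn a ha).measurable.ennreal_ofReal,
        lintegral_ofReal_boxSpline hn a ha, lintegral_enorm_gaussian_sub]

theorem theorem2 (A : (n : ℕ) → Fin n → ℝ)
    (hpos : ∀ n, ∀ j, 0 < A n j)
    (hunit : ∀ n, 1 ≤ n → ∑ j, A n j ^ 2 = 1)
    (hmax : ∀ ε : ℝ, 0 < ε → ∀ᶠ n in atTop, ∀ j, A n j < ε) :
    -- pointwise convergence, in the variable `x`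
    (∀ x : ℝ, Tendsto (fun n => boxSpline (A n) x -
        √(6 / Real.pi) * Real.exp (-6 * (x - (∑ j, A n j) / 2) ^ 2)) atTop (𝓝 0)) ∧
    -- pointwise convergence, in the centred variable `y = x - ∑ j, a j / 2`
    (∀ y : ℝ, Tendsto (fun n => boxSpline (A n) (y + (∑ j, A n j) / 2)) atTop
        (𝓝 (√(6 / Real.pi) * Real.exp (-6 * y ^ 2)))) ∧
    -- convergence in `L^p(ℝ)`, `2 ≤ p < ∞`
    (∀ p : ℝ, 2 ≤ p → Tendsto (fun n => eLpNorm (fun x => boxSpline (A n) x -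
        √(6 / Real.pi) * Real.exp (-6 * (x - (∑ j, A n j) / 2) ^ 2))
          (ENNReal.ofReal p) volume) atTop (𝓝 0)) := by
  have hD := tendsto_integral_abs_prod_sinc_sub_exp A hpos hunit hmax
  have hreg := eventually_regular A hpos hunit hmax
  refine ⟨fun x => ?_, fun y => ?_, fun p hp => ?_⟩
  · refine squeeze_zero_norm' ?_ hD
    filter_upwards [hreg] with n ⟨hn, hu, hle⟩
    exact abs_boxSpline_sub_gaussian_le hn (A n) (hpos n) hu hle x
  · rw [← tendsto_sub_nhds_zero_iff]
    refine squeeze_zero_norm' ?_ hD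
    filter_upwards [hreg] with n ⟨hn, hu, hle⟩
    have h := abs_boxSpline_sub_gaussian_le hn (A n) (hpos n) hu hle (y + (∑ j, A n j) / 2)
    rwa [add_sub_cancel_right] at h
  · set C : ENNReal := 1 + ∫⁻ x, ‖√(6 / Real.pi) * Real.exp (-6 * x ^ 2)‖ₑ with hC
    have hCtop : C ≠ ⊤ := ENNReal.add_ne_top.2 ⟨by simp, lintegral_enorm_gaussian_ne_top⟩
    have hlim : Tendsto (fun n => (ENNReal.ofReal (∫ ξ : ℝ, |∏ j, Real.sinc (Real.pi * A n j * ξ) -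
        Real.exp (-(Real.pi ^ 2 * ξ ^ 2 / 6))|) ^ (p - 1) * C) ^ (1 / p)) atTop (𝓝 0) := by
      have h1 := (ENNReal.tendsto_ofReal hD).ennrpow_const (p - 1)
      rw [ENNReal.ofReal_zero, ENNReal.zero_rpow_of_pos (by linarith)] at h1
      have h2 := (ENNReal.Tendsto.mul_const h1 (Or.inr hCtop)).ennrpow_const (1 / p)
      rwa [zero_mul, ENNReal.zero_rpow_of_pos (by positivity)] at h2
    refine tendsto_of_tendsto_of_tendsto_of_le_of_le' tendsto_const_nhds hlim
      (Eventually.of_forall fun _ => zero_le) ?_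
    filter_upwards [hreg] with n ⟨hn, hu, hle⟩
    exact eLpNorm_le_of_abs_le (by linarith)
      (abs_boxSpline_sub_gaussian_le hn (A n) (hpos n) hu hle)
      (lintegral_enorm_boxSpline_sub_gaussian_le hn (A n) (hpos n) _)
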